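/- Let $d\ge 1$ be an integer, let $r,s>0$ be known real numbers, and let $\lambda=(\lambda_1,\dots,\lambda_d)$ be any vector with $\lambda_i\ge 0$. For $c>0$ and $x\in\mathbb{N}_0^d$ let $$p_c(x\mid\lambda)=\prod_{i=1}^d e^{-c\lambda_i}\frac{(c\lambda_i)^{x_i}}{x_i!}$$ (with $0^0=1$) denote the probability mass function of $d$ independent Poisson variables with means $c\lambda_1,\dots,c\lambda_d$. Let $$p_{\mathrm J}(y\mid x)=\frac{\int_{(0,\infty)^d}p_r(x\mid\theta)\,p_s(y\mid\theta)\,\pi_{\mathrm J}(\theta)\,d\theta}{\int_{(0,\infty)^d}p_r(x\mid\theta)\,\pi_{\mathrm J}(\theta)\,d\theta},\qquad \pi_{\mathrm J}(\theta)=\prod_{i=1}^d\theta_i^{-1/2},$$ be the Bayesian predictive distribution of $y\sim p_s(\cdot\mid\lambda)$ given an independent observation $x\sim p_r(\cdot\mid\lambda)$, based on the Jeffreys prior. Then the integrals converge and $p_{\mathrm J}(y\mid x)>0$ for all $x,y\in\mathbb{N}_0^d$, the series below converge absolutely (with the convention $0\log 0=0$), and the Kullback--Leibler risk of $p_{\mathrm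 J}$ satisfies $$\sum_{x\in\mathbb{N}_0^d}p_r(x\mid\lambda)\sum_{y\in\mathbb{N}_0^d}p_s(y\mid\lambda)\log\frac{p_s(y\mid\lambda)}{p_{\mathrm J}(y\mid x)}<0.52\,d\,\log\frac{r+s}{r}.$$ -/

import Mathlib

open MeasureTheory

namespace PoissonPrediction

noncomputable section

/-- The probability mass function of `Po(c * lam)`: independent Poisson coordinates with means
`c * lam i`, that is `∏ i, exp (-c lam_i) (c lam_i)^{x_i} / x_i!`. -/
def poissonPMF {d : ℕ} (c : ℝ) (lam : Fin d → ℝ) (x : Fin d → ℕ) : ℝ :=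
  ∏ i, (Real.exp (-(c * lam i)) * (c * lam i) ^ x i / (Nat.factorial (x i) : ℝ))

/-- The density of the Jeffreys prior `lam_1^{-1/2} ⋯ lam_d^{-1/2}` (an improper prior). -/
def jeffreysPrior {d : ℕ} (lam : Fin d → ℝ) : ℝ :=
  ∏ i, (lam i) ^ (-(1 / 2) : ℝ)

/-- The open orthant `(0, ∞)^d`, over which the prior is integrated. -/
def orthant (d : ℕ) : Set (Fin d → ℝ) :=
  Set.univ.pi fun _ => Set.Ioi (0 : ℝ)

/-- The Bayesian predictive distribution `p_J(y | x)` for `y ~ Po(s * lam)` given the observation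
`x ~ Po(r * lam)`, based on the Jeffreys prior. -/
def jeffreysPredictive {d : ℕ} (r s : ℝ) (x y : Fin d → ℕ) : ℝ :=
  (∫ lam in orthant d, poissonPMF r lam x * poissonPMF s lam y * jeffreysPrior lam) /
    (∫ lam in orthant d, poissonPMF r lam x * jeffreysPrior lam)

/-- The summand `p(y) log (p(y) / q(y))` of the Kullback-Leibler loss (equal to `0` where
`p(y) = 0`). It is used for `q > 0` only. -/
def klTerm {d : ℕ} (p q : (Fin d → ℕ) → ℝ) (y : Fin d → ℕ) : ℝ :=
  p y * Real.log (p y / q y)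

/-- The Kullback-Leibler loss `D(p, q) = ∑_y p(y) log (p(y) / q(y))`. -/
def klLoss {d : ℕ} (p q : (Fin d → ℕ) → ℝ) : ℝ :=
  ∑' y, klTerm p q y

/-- The summand `p(x | lam) D(p(· | lam), q(· ; x))` of the Kullback-Leibler risk, with
`x ~ Po(r * lam)` observed and `Po(s * lam)` predicted by `q(· ; x)`. -/
def klRiskTerm {d : ℕ} (r s : ℝ) (lam : Fin d → ℝ) (q : (Fin d → ℕ) → (Fin d → ℕ) → ℝ)
    (x : Fin d → ℕ) : ℝ :=
  poissonPMF r lam x * klLoss (poissonPMF s lam) (q x)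

/-- The Kullback-Leibler risk `E(D(p(y | lam), q(y ; x)) | lam)` with `x ~ Po(r * lam)`. -/
def klRisk {d : ℕ} (r s : ℝ) (lam : Fin d → ℝ) (q : (Fin d → ℕ) → (Fin d → ℕ) → ℝ) : ℝ :=
  ∑' x, klRiskTerm r s lam q x

end

end PoissonPrediction

/-! Gamma integrals make the predictive distribution a product over coordinates, so the risk is a
sum of one-dimensional risks. Let `N` be Poisson with mean `m` and `g(m) = E log Γ(N + 1/2) - m log
m + m` (`logGammaGap`). Since `x + y` is Poisson with mean `(r + s) l`, the one-dimensional risk at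
`l` equals `g(r l) - g((r + s) l) + (1/2) log((r + s)/r)` (`hasSum_riskCoord`). As `0.52 = 1/2 +
1/50`, it suffices that `g + (1/50) log` be strictly increasing on the positive axis; `l = 0` is
immediate.

The derivative of a Poisson expectation in `m` is the expectation of the forward difference. Hence
`g'(m) = E log(N + 1/2) - log m`, and the claim becomes `g'(m) > -1/(50 m)` (`poissonExp_log_gt`). A
second differentiation shows that `g'(m) + 1/(50 m)` is strictly decreasing; it is also at least
`-2/m`, so it is positive. The decrease is `poissonExp_log_increment_lt`: the increments of `log(n +
1/2)` are bounded by functions with explicit Poisson expectations plus a finitely supported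
remainder, which leaves the inequality `polynomial_bound` in `m`. -/

namespace PoissonPrediction

/-! ### Poisson expectations of sequences of at most exponential growth. -/

/-- The Poisson probability of `n` with mean `m`. -/
noncomputable def poissonWeight (m : ℝ) (n : ℕ) : ℝ :=
  Real.exp (-m) * m ^ n / (Nat.factorial n : ℝ)

/-- The expectation of `F` under the Poisson distribution with mean `m`. -/
noncomputable def poissonExp (m : ℝ) (F : ℕ → ℝ) : ℝ :=
  ∑' n, poissonWeight m n * F n

/-- Sequences growing at most like `2 ^ n`. -/
def ExpBounded (F : ℕ → ℝ) : Prop :=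
  ∃ C : ℝ, ∀ n, |F n| ≤ C * 2 ^ n

theorem poissonWeight_nonneg {m : ℝ} (hm : 0 ≤ m) (n : ℕ) : 0 ≤ poissonWeight m n := by
  unfold poissonWeight; positivity

theorem ExpBounded.add {F G : ℕ → ℝ} (hF : ExpBounded F) (hG : ExpBounded G) :
    ExpBounded (fun n => F n + G n) := by
  obtain ⟨C, hC⟩ := hF
  obtain ⟨D, hD⟩ := hG
  refine ⟨C + D, fun n => (abs_add_le _ _).trans ?_⟩
  linarith [hC n, hD n, add_mul C D (2 ^ n)]

theorem ExpBounded.const_mul {F : ℕ → ℝ} (hF : ExpBounded F) (c : ℝ) :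
    ExpBounded (fun n => c * F n) := by
  obtain ⟨C, hC⟩ := hF
  refine ⟨|c| * C, fun n => ?_⟩
  rw [abs_mul, mul_assoc]
  exact mul_le_mul_of_nonneg_left (hC n) (abs_nonneg c)

theorem ExpBounded.neg {F : ℕ → ℝ} (hF : ExpBounded F) : ExpBounded (fun n => - F n) := by
  simpa using hF.const_mul (-1)

theorem ExpBounded.sub {F G : ℕ → ℝ} (hF : ExpBounded F) (hG : ExpBounded G) :
    ExpBounded (fun n => F n - G n) := by
  simpa [sub_eq_add_neg] using hF.add hG.neg

theorem expBounded_of_abs_le {F : ℕ → ℝ} (C : ℝ) (h : ∀ n, |F n| ≤ C) : ExpBounded F := by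
  refine ⟨C, fun n => (h n).trans ?_⟩
  have hC : 0 ≤ C := (abs_nonneg _).trans (h 0)
  exact le_mul_of_one_le_right hC (one_le_pow₀ (by norm_num))

theorem expBounded_const (c : ℝ) : ExpBounded (fun _ => c) :=
  expBounded_of_abs_le |c| fun _ => le_rfl

theorem expBounded_natCast : ExpBounded (fun n => (n : ℝ)) := by
  refine ⟨1, fun n => ?_⟩
  rw [abs_of_nonneg (Nat.cast_nonneg n), one_mul]
  have h : ((n : ℕ) : ℝ) ≤ ((2 ^ n : ℕ) : ℝ) := Nat.cast_le.mpr (Nat.lt_two_pow_self (n := n)).le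
  simpa using h

theorem ExpBounded.shift {F : ℕ → ℝ} (hF : ExpBounded F) (k : ℕ) :
    ExpBounded (fun n => F (k + n)) := by
  obtain ⟨C, hC⟩ := hF
  refine ⟨C * 2 ^ k, fun n => (hC _).trans (le_of_eq ?_)⟩
  rw [pow_add]; ring

theorem ExpBounded.exists_nonneg {F : ℕ → ℝ} (hF : ExpBounded F) :
    ∃ C : ℝ, 0 ≤ C ∧ ∀ n, |F n| ≤ C * 2 ^ n := by
  obtain ⟨C, hC⟩ := hF
  refine ⟨C, ?_, hC⟩
  simpa using (abs_nonneg _).trans (hC 0)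

theorem ExpBounded.summable_series {F : ℕ → ℝ} (hF : ExpBounded F) (m : ℝ) :
    Summable (fun n => F n * (m ^ n / (Nat.factorial n : ℝ))) := by
  obtain ⟨C, hC0, hC⟩ := hF.exists_nonneg
  refine Summable.of_norm_bounded
    (g := fun n : ℕ => C * ((2 * |m|) ^ n / (Nat.factorial n : ℝ)))
    ((Real.summable_pow_div_factorial (2 * |m|)).mul_left C) fun n => ?_
  rw [Real.norm_eq_abs, abs_mul, abs_div, abs_pow, Nat.abs_cast, mul_pow, mul_div_assoc,
    ← mul_assoc]
  exact mul_le_mul_of_nonneg_right (hC n) (by positivity)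

theorem poissonWeight_mul_eq (m : ℝ) (F : ℕ → ℝ) (n : ℕ) :
    poissonWeight m n * F n = Real.exp (-m) * (F n * (m ^ n / (Nat.factorial n : ℝ))) := by
  unfold poissonWeight; ring

theorem ExpBounded.summable_poissonWeight {F : ℕ → ℝ} (hF : ExpBounded F) (m : ℝ) :
    Summable (fun n => poissonWeight m n * F n) := by
  simp_rw [poissonWeight_mul_eq]
  exact (hF.summable_series m).mul_left _

theorem ExpBounded.hasSum {F : ℕ → ℝ} (hF : ExpBounded F) (m : ℝ) :
    HasSum (fun n => poissonWeight m n * F n) (poissonExp m F) :=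
  (hF.summable_poissonWeight m).hasSum

theorem poissonExp_eq (m : ℝ) (F : ℕ → ℝ) :
    poissonExp m F = Real.exp (-m) * ∑' n, F n * (m ^ n / (Nat.factorial n : ℝ)) := by
  simp_rw [poissonExp, poissonWeight_mul_eq, tsum_mul_left]

theorem hasSum_poissonWeight (m : ℝ) : HasSum (poissonWeight m) 1 := by
  have h := (NormedSpace.expSeries_div_hasSum_exp m).mul_left (Real.exp (-m))
  rw [← Real.exp_eq_exp_ℝ, ← Real.exp_add, neg_add_cancel, Real.exp_zero] at h
  refine h.congr_fun fun x => ?_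
  simp [poissonWeight, mul_div_assoc]

theorem poissonExp_add {F G : ℕ → ℝ} (hF : ExpBounded F) (hG : ExpBounded G) (m : ℝ) :
    poissonExp m (fun n => F n + G n) = poissonExp m F + poissonExp m G := by
  refine HasSum.tsum_eq ?_
  simpa [mul_add] using (hF.hasSum m).add (hG.hasSum m)

theorem poissonExp_sub {F G : ℕ → ℝ} (hF : ExpBounded F) (hG : ExpBounded G) (m : ℝ) :
    poissonExp m (fun n => F n - G n) = poissonExp m F - poissonExp m G := by
  refine HasSum.tsum_eq ?_
  simpa [mul_sub] using (hF.hasSum m).sub (hG.hasSum m)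

theorem poissonExp_const_mul (F : ℕ → ℝ) (c m : ℝ) :
    poissonExp m (fun n => c * F n) = c * poissonExp m F := by
  unfold poissonExp
  rw [← tsum_mul_left]
  exact tsum_congr fun n => by ring

theorem poissonExp_const (c m : ℝ) : poissonExp m (fun _ => c) = c := by
  have h := (hasSum_poissonWeight m).mul_right c
  rw [one_mul] at h
  exact h.tsum_eq

theorem poissonExp_mono {F G : ℕ → ℝ} (hF : ExpBounded F) (hG : ExpBounded G) {m : ℝ}
    (hm : 0 ≤ m) (h : ∀ n, F n ≤ G n) : poissonExp m F ≤ poissonExp m G :=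
  (hF.summable_poissonWeight m).tsum_le_tsum
    (fun n => mul_le_mul_of_nonneg_left (h n) (poissonWeight_nonneg hm n))
    (hG.summable_poissonWeight m)

/-- Stein's identity for the Poisson distribution. -/
theorem poissonExp_natCast_mul {F : ℕ → ℝ} (m : ℝ)
    (hF : Summable fun n : ℕ => poissonWeight m n * (n * F n)) :
    poissonExp m (fun n => n * F n) = m * poissonExp m (fun n => F (n + 1)) := by
  unfold poissonExp
  rw [hF.tsum_eq_zero_add, ← tsum_mul_left]
  simp only [Nat.cast_zero, zero_mul, mul_zero, zero_add]
  refine tsum_congr fun n => ?_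
  unfold poissonWeight
  rw [Nat.factorial_succ]
  push_cast
  field_simp
  ring

theorem poissonExp_natCast (m : ℝ) : poissonExp m (fun n => (n : ℝ)) = m := by
  have h := poissonExp_natCast_mul (F := fun _ => 1) m
    (by simpa using expBounded_natCast.summable_poissonWeight m)
  simpa [poissonExp_const] using h

/-- Termwise differentiation of an exponential generating function shifts its coefficients. The
differentiated series is dominated uniformly on the ball of radius `|m| + 1`. -/
theorem ExpBounded.hasDerivAt_series {F : ℕ → ℝ} (hF : ExpBounded F) (m : ℝ) :
    HasDerivAt (fun y : ℝ => ∑' n, F n * (y ^ n / (Nat.factorial n : ℝ)))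
      (∑' n, F (n + 1) * (m ^ n / (Nat.factorial n : ℝ))) m := by
  obtain ⟨C, hC0, hC⟩ := hF.exists_nonneg
  set R : ℝ := |m| + 1
  have hR : 0 < R := by positivity
  have hcancel : ∀ (y : ℝ) (n : ℕ), ((n + 1 : ℕ) : ℝ) * y ^ (n + 1 - 1) / ((n + 1).factorial : ℝ)
      = y ^ n / (n.factorial : ℝ) := by
    intro y n
    rw [Nat.factorial_succ, Nat.add_sub_cancel]
    push_cast
    field_simp
  have hu : Summable (fun n : ℕ => C * 2 ^ n * (n * R ^ (n - 1) / (n.factorial : ℝ))) := by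
    rw [← summable_nat_add_iff 1]
    simp_rw [hcancel]
    refine ((Real.summable_pow_div_factorial (2 * R)).mul_left (C * 2)).congr fun n => ?_
    rw [mul_pow, pow_succ]; ring
  have hder := hasDerivAt_tsum_of_isPreconnected
    (g := fun n (y : ℝ) => F n * (y ^ n / (n.factorial : ℝ)))
    (g' := fun n (y : ℝ) => F n * (n * y ^ (n - 1) / (n.factorial : ℝ)))
    (t := Metric.ball (0 : ℝ) R) (y₀ := 0) (y := m) hu Metric.isOpen_ball
    (convex_ball (0 : ℝ) R).isPreconnected
    (fun n y _ => ((hasDerivAt_pow n y).div_const _).const_mul _)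
    (fun n y hy => by
      have hy' : |y| ≤ R := by
        rw [mem_ball_zero_iff, Real.norm_eq_abs] at hy; exact hy.le
      rw [Real.norm_eq_abs, abs_mul, abs_div, abs_mul, abs_pow, Nat.abs_cast, Nat.abs_cast]
      refine mul_le_mul (hC n) ?_ (by positivity) (by positivity)
      gcongr)
    (Metric.mem_ball_self hR) (hF.summable_series 0)
    (by rw [mem_ball_zero_iff, Real.norm_eq_abs]; exact lt_add_one _)
  have hs : Summable (fun n : ℕ => F n * (n * m ^ (n - 1) / (n.factorial : ℝ))) := by
    rw [← summable_nat_add_iff 1]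
    simp_rw [hcancel]
    simpa [add_comm] using (hF.shift 1).summable_series m
  rw [hs.tsum_eq_zero_add] at hder
  simp_rw [hcancel] at hder
  simpa using hder

/-- The shifted series gives `F (n + 1)`, and the factor `exp (-m)` contributes `-F n`. -/
theorem ExpBounded.hasDerivAt_poissonExp {F : ℕ → ℝ} (hF : ExpBounded F) (m : ℝ) :
    HasDerivAt (fun y => poissonExp y F) (poissonExp m (fun n => F (n + 1) - F n)) m := by
  have hsh : ExpBounded (fun n => F (n + 1)) := by simpa [add_comm] using hF.shift 1
  rw [poissonExp_sub hsh hF]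
  simp_rw [poissonExp_eq]
  have h1 : HasDerivAt (fun y : ℝ => Real.exp (-y)) (-Real.exp (-m)) m := by
    simpa using (hasDerivAt_neg m).exp
  exact (h1.mul (hF.hasDerivAt_series m)).congr_deriv (by ring)

theorem poissonWeight_add (a b : ℝ) (n : ℕ) :
    ∑ p ∈ Finset.HasAntidiagonal.antidiagonal n, poissonWeight a p.1 * poissonWeight b p.2
      = poissonWeight (a + b) n := by
  unfold poissonWeight
  rw [(Commute.all a b).add_pow', neg_add, Real.exp_add, Finset.mul_sum, Finset.sum_div]
  refine Finset.sum_congr rfl fun p hp => ?_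
  rw [Finset.HasAntidiagonal.mem_antidiagonal] at hp
  subst hp
  have h := Nat.add_choose_mul_factorial_mul_factorial p.1 p.2
  rw [← Nat.choose_symm_add] at h
  have h' : (((p.1 + p.2).choose p.1 : ℕ) : ℝ) * p.1.factorial * p.2.factorial
      = ((p.1 + p.2).factorial : ℝ) := by exact_mod_cast h
  rw [nsmul_eq_mul, ← h']
  have : (((p.1 + p.2).choose p.1 : ℕ) : ℝ) ≠ 0 := by
    exact_mod_cast (Nat.choose_pos (Nat.le_add_right _ _)).ne'
  field_simp

/-- The bound `2 ^ (x + y)` factors, so a product of two convergent series dominates. This justifies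
regrouping the double sum along antidiagonals. -/
theorem ExpBounded.summable_prod {F : ℕ → ℝ} (hF : ExpBounded F) {a b : ℝ} (ha : 0 ≤ a)
    (hb : 0 ≤ b) :
    Summable (fun p : ℕ × ℕ => poissonWeight a p.1 * poissonWeight b p.2 * F (p.1 + p.2)) := by
  obtain ⟨C, hC0, hC⟩ := hF.exists_nonneg
  have h2 : ExpBounded (fun n => (2 : ℝ) ^ n) := ⟨1, fun n => by simp⟩
  have hs := ((h2.summable_poissonWeight a).mul_of_nonneg (h2.summable_poissonWeight b)
    (fun n => mul_nonneg (poissonWeight_nonneg ha n) (by positivity))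
    (fun n => mul_nonneg (poissonWeight_nonneg hb n) (by positivity))).mul_left C
  refine Summable.of_norm_bounded hs fun p => ?_
  have hw := mul_nonneg (poissonWeight_nonneg ha p.1) (poissonWeight_nonneg hb p.2)
  rw [Real.norm_eq_abs, abs_mul, abs_of_nonneg hw]
  refine (mul_le_mul_of_nonneg_left (hC _) hw).trans (le_of_eq ?_)
  rw [pow_add]; ring

/-- The sum of independent Poisson variables is Poisson. -/
theorem ExpBounded.hasSum_conv {F : ℕ → ℝ} (hF : ExpBounded F) {a b : ℝ} (ha : 0 ≤ a)
    (hb : 0 ≤ b) :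
    HasSum (fun x => poissonWeight a x * poissonExp b (fun y => F (x + y)))
      (poissonExp (a + b) F) := by
  have hs := hF.summable_prod ha hb
  have h1 : HasSum (fun x => poissonWeight a x * poissonExp b (fun y => F (x + y)))
      (∑' p : ℕ × ℕ, poissonWeight a p.1 * poissonWeight b p.2 * F (p.1 + p.2)) := by
    refine hs.hasSum.prod_fiberwise fun x => ?_
    simpa [mul_assoc] using ((hF.shift x).hasSum b).mul_left (poissonWeight a x)
  convert h1 using 1
  have hs' := (Finset.HasAntidiagonal.sigmaAntidiagonalEquivProd (A := ℕ)).summable_iff.mpr hs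
  rw [← (Finset.HasAntidiagonal.sigmaAntidiagonalEquivProd (A := ℕ)).tsum_eq
    (fun p : ℕ × ℕ => poissonWeight a p.1 * poissonWeight b p.2 * F (p.1 + p.2))]
  refine Eq.trans ?_ (Summable.tsum_sigma' (fun n => (hasSum_fintype _).summable) hs').symm
  refine tsum_congr fun n => ?_
  rw [tsum_fintype, ← poissonWeight_add, Finset.sum_mul, ← Finset.sum_coe_sort]
  refine Finset.sum_congr rfl fun p _ => ?_
  have := Finset.HasAntidiagonal.mem_antidiagonal.mp p.2
  simp [Finset.HasAntidiagonal.sigmaAntidiagonalEquivProd, this]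

/-! ### Increments of `log (n + 1/2)` and their comparison functions. -/

/-- With `u = 1/(2n + 2)`, the increment is the series of terms `2 u^(2k+1)/(2k+1)`. Replacing
`1/(2k+1)` by `1/3` for `k ≥ 1` leaves `2u` plus a geometric series. -/
theorem log_ratio_le (n : ℕ) :
    Real.log ((n + 1 : ℕ) + 1 / 2) - Real.log (n + 1 / 2)
      ≤ 1 / (n + 1) + 1 / (3 * (n + 1) * (2 * n + 1) * (2 * n + 3)) := by
  have hn : (0 : ℝ) ≤ n := Nat.cast_nonneg n
  set u : ℝ := 1 / (2 * (n + 1 / 2) + 1) with hu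
  have hu0 : 0 < u := by positivity
  have hu1 : u ^ 2 < 1 := by
    have : u < 1 := by
      rw [hu, div_lt_one (by positivity)]; linarith
    nlinarith
  have h1 := Real.hasSum_log_one_add_inv (a := (n : ℝ) + 1 / 2) (by positivity)
  -- The extra `4/3 * u` restores the exact term `2u` at `k = 0`.
  have h2 : HasSum (fun k : ℕ => 2 / 3 * u * (u ^ 2) ^ k + if k = 0 then 4 / 3 * u else 0)
      (2 / 3 * u * (1 - u ^ 2)⁻¹ + 4 / 3 * u) :=
    ((hasSum_geometric_of_lt_one (by positivity) hu1).mul_left _).add (hasSum_ite_eq 0 _)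
  have h3 := hasSum_le (fun k => ?_) h1 h2
  · have e1 : Real.log ((n + 1 : ℕ) + 1 / 2) - Real.log (n + 1 / 2)
        = Real.log (1 + ((n : ℝ) + 1 / 2)⁻¹) := by
      rw [← Real.log_div (by positivity) (by positivity)]
      congr 1
      push_cast
      field_simp
      ring
    rw [e1]
    refine h3.trans (le_of_eq ?_)
    have e2 : 1 - u ^ 2 = (2 * n + 1) * (2 * n + 3) / (2 * n + 2) ^ 2 := by
      rw [hu]; field_simp; ring
    rw [e2, hu]
    field_simp
    ring
  · rw [← hu]
    rcases k with _ | k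
    · simp; linarith
    · have hk : (1 : ℝ) / (2 * ((k + 1 : ℕ) : ℝ) + 1) ≤ 1 / 3 := by
        apply one_div_le_one_div_of_le (by norm_num)
        push_cast; linarith [(Nat.cast_nonneg k : (0 : ℝ) ≤ k)]
      have : 0 ≤ u ^ (2 * (k + 1) + 1) := by positivity
      calc 2 * (1 / (2 * ((k + 1 : ℕ) : ℝ) + 1)) * u ^ (2 * (k + 1) + 1)
          ≤ 2 * (1 / 3) * u ^ (2 * (k + 1) + 1) := by gcongr
        _ = _ := by rw [if_neg (Nat.succ_ne_zero k), pow_succ, pow_mul]; ring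

/-- Dividing by `n + 1` turns the weight at `n` into the weight at `n + 1` over `m`, so the total
mass without its zeroth term remains. -/
theorem poissonExp_inv_succ {m : ℝ} (hm : 0 < m) :
    poissonExp m (fun n => 1 / ((n : ℝ) + 1)) = (1 - Real.exp (-m)) / m := by
  have h := (hasSum_poissonWeight m).tsum_eq
  rw [(hasSum_poissonWeight m).summable.tsum_eq_zero_add] at h
  have e : ∀ n, poissonWeight m (n + 1) = m * (poissonWeight m n * (1 / ((n : ℝ) + 1))) := by
    intro n
    unfold poissonWeight
    rw [Nat.factorial_succ]; push_cast; field_simp; ring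
  simp_rw [e] at h
  rw [tsum_mul_left] at h
  have h0 : poissonWeight m 0 = Real.exp (-m) := by simp [poissonWeight]
  rw [poissonExp, eq_div_iff hm.ne']
  linarith

theorem poissonExp_inv_succ_mul_succ {m : ℝ} (hm : 0 < m) :
    poissonExp m (fun n => 1 / (((n : ℝ) + 1) * (n + 2)))
      = (1 - Real.exp (-m) - m * Real.exp (-m)) / m ^ 2 := by
  have h := (hasSum_poissonWeight m).tsum_eq
  have hs := (hasSum_poissonWeight m).summable
  rw [hs.tsum_eq_zero_add, ((summable_nat_add_iff 1).mpr hs).tsum_eq_zero_add] at h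
  have e : ∀ n, poissonWeight m (n + 1 + 1)
      = m ^ 2 * (poissonWeight m n * (1 / (((n : ℝ) + 1) * (n + 2)))) := by
    intro n
    unfold poissonWeight
    rw [Nat.factorial_succ, Nat.factorial_succ]; push_cast; field_simp; ring
  simp_rw [e] at h
  rw [tsum_mul_left] at h
  have h0 : poissonWeight m 0 = Real.exp (-m) := by simp [poissonWeight]
  have h1 : poissonWeight m (0 + 1) = m * Real.exp (-m) := by simp [poissonWeight, mul_comm]
  rw [poissonExp, eq_div_iff (by positivity)]
  linarith

/-- The part of the bound for the increments of `log (n + 1 / 2)` that is not controlled by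
multiples of `1 / (n + 1)` and `1 / ((n + 1) (n + 2))`, cut off where it is negative. -/
noncomputable def incrementExcess (n : ℕ) : ℝ :=
  if n < 10 then 1 / (3 * ((n : ℝ) + 1) * (2 * n + 1) * (2 * n + 3))
    - 1 / 50 * (1 / (((n : ℝ) + 1) * (n + 2))) else 0

/-- For `n ≥ 10` this reduces to `50 (n + 2) ≤ 3 (2n + 1)(2n + 3)`, which already holds from `n =
5`. The values of `incrementExcess` at `5, ..., 9` are therefore negative; they are retained for use
in `polynomial_bound`. -/
theorem inv_cubic_le (n : ℕ) :
    1 / (3 * ((n : ℝ) + 1) * (2 * n + 1) * (2 * n + 3))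
      ≤ 1 / 50 * (1 / (((n : ℝ) + 1) * (n + 2))) + incrementExcess n := by
  unfold incrementExcess
  split_ifs with h
  · linarith
  · have hn : (10 : ℝ) ≤ n := by exact_mod_cast not_lt.mp h
    rw [add_zero, one_div_mul_one_div]
    apply one_div_le_one_div_of_le (by positivity)
    nlinarith [mul_nonneg (sub_nonneg.mpr hn) (sub_nonneg.mpr hn), sq_nonneg (n : ℝ)]

theorem expBounded_incrementExcess : ExpBounded incrementExcess := by
  refine expBounded_of_abs_le 1 fun n => ?_
  unfold incrementExcess
  split_ifs with h
  · have hn : (0 : ℝ) ≤ n := Nat.cast_nonneg n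
    have h1 : 1 / (3 * ((n : ℝ) + 1) * (2 * n + 1) * (2 * n + 3)) ≤ 1 := by
      rw [div_le_one (by positivity)]
      nlinarith [mul_nonneg hn hn, mul_nonneg (mul_nonneg hn hn) hn]
    have h2 : 1 / (((n : ℝ) + 1) * (n + 2)) ≤ 1 := by
      rw [div_le_one (by positivity)]
      nlinarith [mul_nonneg hn hn]
    have h3 : 0 ≤ 1 / (3 * ((n : ℝ) + 1) * (2 * n + 1) * (2 * n + 3)) := by positivity
    have h4 : 0 ≤ 1 / (((n : ℝ) + 1) * (n + 2)) := by positivity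
    rw [abs_le]; constructor <;> linarith
  · simp

theorem sum_incrementExcess (m : ℝ) :
    ∑ n ∈ Finset.range 10, incrementExcess n * (m ^ n / (n.factorial : ℝ))
      = 91 / 900 + 7 / 900 * m + 19 / 25200 * m ^ 2 + 61 / 1134000 * m ^ 3 + 1 / 3564000 *
        m ^ 4 - 79 / 108108000 * m ^ 5 - 37 / 235872000 * m ^ 6 - 1 / 44064000 * m ^ 7 -
        67 / 25116480000 * m ^ 8 - 647 / 2389020480000 * m ^ 9 := by
  simp only [Finset.sum_range_succ, Finset.sum_range_zero, incrementExcess, Nat.factorial]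
  norm_num
  ring

/-- The negative coefficients of degrees 5 to 9 make the inequality possible for large `m`, where
the positive ones alone would violate it. -/
theorem polynomial_bound {m : ℝ} (hm : 0 < m) :
    m ^ 2 * ∑ n ∈ Finset.range 10, incrementExcess n * (m ^ n / (n.factorial : ℝ))
      < 1 / 50 + 51 / 50 * m := by
  rw [sum_incrementExcess]
  rcases le_total m 5 with h5 | h5
  -- For `m ≤ 5` the negative terms can be dropped: the left side is then at most `m ^ 2 / 5 ≤ m`.
  · have h : 91 / 900 + 7 / 900 * m + 19 / 25200 * m ^ 2 + 61 / 1134000 * m ^ 3 + 1 / 3564000 * m ^ 4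
        ≤ 1 / 5 := by
      have h2 : m ^ 2 ≤ 5 ^ 2 := by gcongr
      have h3 : m ^ 3 ≤ 5 ^ 3 := by gcongr
      have h4 : m ^ 4 ≤ 5 ^ 4 := by gcongr
      linarith
    have hp : 0 ≤ 79 / 108108000 * m ^ 5 + 37 / 235872000 * m ^ 6 + 1 / 44064000 * m ^ 7 + 67 /
        25116480000 * m ^ 8 + 647 / 2389020480000 * m ^ 9 := by
      positivity
    calc _ ≤ m ^ 2 * (1 / 5) := by
          refine mul_le_mul_of_nonneg_left ?_ (by positivity)
          linarith
      _ ≤ 5 * m * (1 / 5) := by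
          refine mul_le_mul_of_nonneg_right ?_ (by norm_num)
          nlinarith
      _ < _ := by linarith
  · obtain ⟨t, rfl⟩ : ∃ t, m = 5 + t := ⟨m - 5, by ring⟩
    have ht : 0 ≤ t := by linarith
    rcases le_total t 1 with h1 | h1
    -- The quadratic is a minorant, positive on `[0, 1]`, chosen so that the difference has only
    -- nonnegative coefficients in `t`. The case `m ≥ 6` below uses the same device, with a
    -- quadratic of negative discriminant whose minimum is at `u = 67/74`.
    · have h : 1 - 8 / 10 * t - 15 / 100 * t ^ 2 ≤ 1 / 50 + 51 / 50 * (5 + t)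
          - (5 + t) ^ 2 * (91 / 900 + 7 / 900 * (5 + t) + 19 / 25200 * (5 + t) ^ 2 + 61 / 1134000 * (5 +
            t) ^ 3 + 1 / 3564000 * (5 + t) ^ 4 - 79 / 108108000 * (5 + t) ^ 5 - 37 /
            235872000 * (5 + t) ^ 6 - 1 / 44064000 * (5 + t) ^ 7 - 67 / 25116480000 * (5 +
            t) ^ 8 - 647 / 2389020480000 * (5 + t) ^ 9) := by
        rw [← sub_nonneg]
        ring_nf
        positivity
      nlinarith
    · obtain ⟨u, rfl⟩ : ∃ u, t = 1 + u := ⟨t - 1, by ring⟩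
      have hu : 0 ≤ u := by linarith
      have h : 36 / 100 - 67 / 100 * u + 37 / 100 * u ^ 2 ≤ 1 / 50 + 51 / 50 * (5 + (1 + u))
          - (5 + (1 + u)) ^ 2 * (91 / 900 + 7 / 900 * (5 + (1 + u)) + 19 / 25200 * (5 + (1 + u)) ^ 2 + 61 /
            1134000 * (5 + (1 + u)) ^ 3 + 1 / 3564000 * (5 + (1 + u)) ^ 4 - 79 / 108108000
            * (5 + (1 + u)) ^ 5 - 37 / 235872000 * (5 + (1 + u)) ^ 6 - 1 / 44064000 * (5 +
            (1 + u)) ^ 7 - 67 / 25116480000 * (5 + (1 + u)) ^ 8 - 647 / 2389020480000 * (5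
            + (1 + u)) ^ 9) := by
        rw [← sub_nonneg]
        ring_nf
        positivity
      nlinarith [sq_nonneg (u - 67 / 74)]

/-! ### The Poisson expectation of `log (N + 1/2)` against `log m`. -/

theorem expBounded_log : ExpBounded (fun n => Real.log (n + 1 / 2)) := by
  refine ⟨1, fun n => ?_⟩
  rw [one_mul]
  rcases n with _ | n
  · have h : Real.log ((0 : ℕ) + 1 / 2) = - Real.log 2 := by
      rw [← Real.log_inv]; norm_num
    beta_reduce
    rw [h, abs_neg, abs_of_pos (Real.log_pos (by norm_num))]
    have := Real.log_two_lt_d9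
    norm_num; linarith
  · have hn : (0 : ℝ) ≤ n := Nat.cast_nonneg n
    have h0 : 0 ≤ Real.log ((n + 1 : ℕ) + 1 / 2) :=
      Real.log_nonneg (by push_cast; linarith)
    have h1 : (((n + 1 : ℕ) : ℕ) : ℝ) ≤ ((2 ^ (n + 1) : ℕ) : ℝ) :=
      Nat.cast_le.mpr (Nat.lt_two_pow_self (n := n + 1)).le
    rw [abs_of_nonneg h0]
    refine (Real.log_le_sub_one_of_pos (by push_cast; linarith)).trans ?_
    push_cast at h1 ⊢
    linarith

theorem expBounded_inv_succ : ExpBounded (fun n => 1 / ((n : ℝ) + 1)) := by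
  refine expBounded_of_abs_le 1 fun n => ?_
  rw [abs_of_nonneg (by positivity), div_le_one (by positivity)]
  linarith [(Nat.cast_nonneg n : (0 : ℝ) ≤ n)]

theorem expBounded_inv_succ_mul_succ :
    ExpBounded (fun n => 1 / (((n : ℝ) + 1) * (n + 2))) := by
  refine expBounded_of_abs_le 1 fun n => ?_
  have hn : (0 : ℝ) ≤ n := Nat.cast_nonneg n
  rw [abs_of_nonneg (by positivity), div_le_one (by positivity)]
  nlinarith

theorem expBounded_log_increment :
    ExpBounded (fun n => Real.log ((n + 1 : ℕ) + 1 / 2) - Real.log (n + 1 / 2)) := by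
  have h := expBounded_log.shift 1
  simp_rw [add_comm 1] at h
  exact h.sub expBounded_log

theorem poissonExp_incrementExcess (m : ℝ) :
    poissonExp m incrementExcess = Real.exp (-m) *
      ∑ n ∈ Finset.range 10, incrementExcess n * (m ^ n / (n.factorial : ℝ)) := by
  rw [poissonExp_eq, tsum_eq_sum]
  intro n hn
  rw [incrementExcess, if_neg (by simpa using hn), zero_mul]

theorem poissonExp_log_increment_lt {m : ℝ} (hm : 0 < m) :
    poissonExp m (fun n => Real.log ((n + 1 : ℕ) + 1 / 2) - Real.log (n + 1 / 2))
      < 1 / m + 1 / 50 / m ^ 2 := by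
  have hb := expBounded_inv_succ_mul_succ.const_mul (1 / 50)
  have hle := poissonExp_mono expBounded_log_increment
    ((expBounded_inv_succ.add hb).add expBounded_incrementExcess) hm.le fun n =>
      show _ ≤ 1 / ((n : ℝ) + 1) + 1 / 50 * (1 / (((n : ℝ) + 1) * (n + 2))) + incrementExcess n by
        linarith [log_ratio_le n, inv_cubic_le n]
  rw [poissonExp_add (expBounded_inv_succ.add hb) expBounded_incrementExcess,
    poissonExp_add expBounded_inv_succ hb, poissonExp_const_mul, poissonExp_inv_succ hm,
    poissonExp_inv_succ_mul_succ hm, poissonExp_incrementExcess] at hle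
  refine hle.trans_lt ?_
  have hp := mul_lt_mul_of_pos_left (polynomial_bound hm) (Real.exp_pos (-m))
  set S := ∑ n ∈ Finset.range 10, incrementExcess n * (m ^ n / (n.factorial : ℝ))
  rw [← sub_pos]
  -- The terms without `exp (-m)` cancel, so the gap is `exp (-m) / m ^ 2` times the gap in
  -- `polynomial_bound`.
  have e : 1 / m + 1 / 50 / m ^ 2 - ((1 - Real.exp (-m)) / m
      + 1 / 50 * ((1 - Real.exp (-m) - m * Real.exp (-m)) / m ^ 2) + Real.exp (-m) * S)
      = (Real.exp (-m) * (1 / 50 + 51 / 50 * m) - Real.exp (-m) * (m ^ 2 * S)) / m ^ 2 := by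
    field_simp
    ring
  rw [e]
  exact div_pos (by linarith) (by positivity)

/-- A crude bound that serves only to control the behaviour as `m → ∞`. It comes from `log x ≤ x -
1` at `x = m/(n + 1/2)`, with `1/(n + 1/2)` majorized by functions of explicit expectation. -/
theorem poissonExp_log_ge {m : ℝ} (hm : 0 < m) :
    Real.log m - 2 / m ≤ poissonExp m (fun n => Real.log (n + 1 / 2)) := by
  have hb := expBounded_inv_succ_mul_succ.const_mul 2
  have hF := ((expBounded_inv_succ.add hb).const_mul m)
  have hle := poissonExp_mono ((expBounded_const (Real.log m + 1)).sub hF) expBounded_log hm.le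
    fun n => show Real.log m + 1 - m * (1 / ((n : ℝ) + 1) + 2 * (1 / (((n : ℝ) + 1) * (n + 2))))
        ≤ Real.log (n + 1 / 2) by
      have hn : (0 : ℝ) ≤ n := Nat.cast_nonneg n
      have h1 := Real.log_le_sub_one_of_pos (x := m / (n + 1 / 2)) (by positivity)
      rw [Real.log_div hm.ne' (by positivity)] at h1
      have h2 : 1 / ((n : ℝ) + 1 / 2)
          ≤ 1 / ((n : ℝ) + 1) + 2 * (1 / (((n : ℝ) + 1) * (n + 2))) := by
        rw [← sub_nonneg]
        have : 1 / ((n : ℝ) + 1) + 2 * (1 / (((n : ℝ) + 1) * (n + 2))) - 1 / ((n : ℝ) + 1 / 2)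
            = 3 * n / ((n + 1) * (n + 2) * (2 * n + 1)) := by
          field_simp
          ring
        rw [this]
        positivity
      have h3 := mul_le_mul_of_nonneg_left h2 hm.le
      rw [mul_one_div] at h3
      linarith
  rw [poissonExp_sub (expBounded_const _) hF, poissonExp_const, poissonExp_const_mul,
    poissonExp_add expBounded_inv_succ hb, poissonExp_const_mul, poissonExp_inv_succ hm,
    poissonExp_inv_succ_mul_succ hm] at hle
  refine le_trans ?_ hle
  have h0 := Real.exp_pos (-m)
  have e : m * ((1 - Real.exp (-m)) / m
      + 2 * ((1 - Real.exp (-m) - m * Real.exp (-m)) / m ^ 2))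
      = 1 + 2 / m - (Real.exp (-m) + 2 * Real.exp (-m) / m + 2 * Real.exp (-m)) := by
    field_simp
    ring
  rw [e]
  have : 0 < 2 * Real.exp (-m) / m := by positivity
  linarith

/-- The expectation of `log (N + 1 / 2)` for a Poisson variable `N` with mean `m` is close to
`log m` from below. -/
theorem poissonExp_log_gt {m : ℝ} (hm : 0 < m) :
    Real.log m - 1 / 50 / m < poissonExp m (fun n => Real.log (n + 1 / 2)) := by
  -- `G` is strictly decreasing and satisfies `G y ≥ -2/y`, so it cannot take a value `≤ 0`.
  set G : ℝ → ℝ := fun y => poissonExp y (fun n => Real.log (n + 1 / 2)) - Real.log y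
    + 1 / 50 * y⁻¹ with hG
  have hder : ∀ y : ℝ, 0 < y → HasDerivAt G
      (poissonExp y (fun n => Real.log ((n + 1 : ℕ) + 1 / 2) - Real.log (n + 1 / 2)) - y⁻¹
        + 1 / 50 * (-(y ^ 2)⁻¹)) y := fun y hy =>
    ((expBounded_log.hasDerivAt_poissonExp y).sub (Real.hasDerivAt_log hy.ne')).add
      ((hasDerivAt_inv hy.ne').const_mul _)
  have hanti : StrictAntiOn G (Set.Ioi 0) := by
    refine strictAntiOn_of_deriv_neg (convex_Ioi 0)
      (fun y hy => (hder y hy).continuousAt.continuousWithinAt) fun y hy => ?_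
    rw [interior_Ioi] at hy
    rw [(hder y hy).deriv]
    have := poissonExp_log_increment_lt (Set.mem_Ioi.mp hy)
    rw [one_div y, div_eq_mul_inv _ (y ^ 2)] at this
    linarith
  by_contra! hle
  have hGm : G m ≤ 0 := by
    simp only [hG]
    rw [← div_eq_mul_inv]; linarith
  have h1 : G (m + 1) < 0 :=
    (hanti hm (Set.mem_Ioi.mpr (by linarith)) (by linarith)).trans_le hGm
  -- This `y` is large enough that `-2/y ≥ G (m + 1)`, which contradicts `-2/y ≤ G y < G (m + 1)`.
  set y := m + 1 + 2 / (-G (m + 1)) with hy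
  have hpos : 0 < 2 / (-G (m + 1)) := div_pos two_pos (by linarith)
  have hy0 : 0 < y := by linarith
  have h2 : G y < G (m + 1) :=
    hanti (Set.mem_Ioi.mpr (by linarith)) (Set.mem_Ioi.mpr hy0) (by linarith)
  have h3 := poissonExp_log_ge hy0
  have h4 : -(2 / y) ≤ G y := by
    simp only [hG]
    have : 0 < y⁻¹ := inv_pos.mpr hy0
    linarith
  have h5 : 2 / y ≤ -G (m + 1) := by
    rw [div_le_iff₀ hy0]
    have : 2 = -G (m + 1) * (2 / (-G (m + 1))) := by field_simp [h1.ne]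
    calc (2 : ℝ) = -G (m + 1) * (2 / (-G (m + 1))) := this
      _ ≤ _ := mul_le_mul_of_nonneg_left (by linarith) (by linarith)
  linarith

/-! ### The Poisson expectation of `log Γ(N + 1/2)`. -/

theorem log_Gamma_succ (n : ℕ) :
    Real.log (Real.Gamma ((n + 1 : ℕ) + 1 / 2))
      = Real.log (Real.Gamma (n + 1 / 2)) + Real.log (n + 1 / 2) := by
  have hn : (0 : ℝ) < n + 1 / 2 := by positivity
  have : ((n + 1 : ℕ) : ℝ) + 1 / 2 = (n + 1 / 2) + 1 := by push_cast; ring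
  rw [this, Real.Gamma_add_one hn.ne', Real.log_mul hn.ne' (Real.Gamma_pos_of_pos hn).ne', add_comm]

theorem expBounded_log_Gamma : ExpBounded (fun n => Real.log (Real.Gamma (n + 1 / 2))) := by
  obtain ⟨C, hC0, hC⟩ := expBounded_log.exists_nonneg
  refine ⟨|Real.log (Real.Gamma ((0 : ℕ) + 1 / 2))| + C, fun n => ?_⟩
  induction n with
  | zero => simpa using hC0
  | succ n ih =>
    beta_reduce at ih ⊢
    rw [log_Gamma_succ, pow_succ]
    refine (abs_add_le _ _).trans ?_
    have h0 : 0 ≤ |Real.log (Real.Gamma ((0 : ℕ) + 1 / 2))| * 2 ^ n := by positivity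
    linarith [hC n]

/-- The Poisson expectation of `log Γ(N + 1 / 2)`, compared with its leading term. -/
noncomputable def logGammaGap (m : ℝ) : ℝ :=
  poissonExp m (fun n => Real.log (Real.Gamma (n + 1 / 2))) - m * Real.log m + m

/-- By `Γ(z + 1) = z Γ(z)` the forward difference of `log Γ(n + 1/2)` is `log (n + 1/2)`, so
positivity of the derivative is exactly `poissonExp_log_gt`. -/
theorem logGammaGap_add_log_strictMonoOn :
    StrictMonoOn (fun m => logGammaGap m + 1 / 50 * Real.log m) (Set.Ioi 0) := by
  have hder : ∀ y : ℝ, 0 < y → HasDerivAt (fun m => logGammaGap m + 1 / 50 * Real.log m)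
      (poissonExp y (fun n => Real.log (n + 1 / 2)) - (Real.log y + 1) + 1 + 1 / 50 * y⁻¹) y := by
    intro y hy
    have h := expBounded_log_Gamma.hasDerivAt_poissonExp y
    simp_rw [log_Gamma_succ, add_sub_cancel_left] at h
    exact ((h.sub (Real.hasDerivAt_mul_log hy.ne')).add (hasDerivAt_id y)).add
      ((Real.hasDerivAt_log hy.ne').const_mul _)
  refine strictMonoOn_of_deriv_pos (convex_Ioi 0)
    (fun y hy => (hder y hy).continuousAt.continuousWithinAt) fun y hy => ?_
  rw [interior_Ioi] at hy
  rw [(hder y hy).deriv]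
  have := poissonExp_log_gt (Set.mem_Ioi.mp hy)
  rw [div_eq_mul_inv _ y] at this
  linarith

/-! ### Sums over product index sets. -/

theorem hasSum_mul_prod {α β : Type*} {f : α → ℝ} {g : β → ℝ} {a b : ℝ} (hf : HasSum f a)
    (hg : HasSum g b) : HasSum (fun p : α × β => f p.1 * g p.2) (a * b) :=
  hf.mul hg (summable_mul_of_summable_norm hf.summable.norm hg.summable.norm)

theorem hasSum_pi_prod {d : ℕ} {f : Fin d → ℕ → ℝ} {a : Fin d → ℝ}
    (hf : ∀ i, HasSum (f i) (a i)) :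
    HasSum (fun x : Fin d → ℕ => ∏ i, f i (x i)) (∏ i, a i) := by
  induction d with
  | zero => simp
  | succ d ih =>
    have h1 := ih fun i => hf i.succ
    have h2 := hasSum_mul_prod (hf 0) h1
    rw [← (Fin.consEquiv fun _ => ℕ).hasSum_iff, Fin.prod_univ_succ]
    refine h2.congr_fun fun p => ?_
    simp [Fin.consEquiv, Fin.prod_univ_succ]

/-- Additivity of expectation over independent coordinates: in the `i`-th summand every factor but
the `i`-th sums to 1. It is applied once to the loss and once to the risk. -/
theorem hasSum_pi_prod_mul_sum {d : ℕ} {p l : Fin d → ℕ → ℝ} {a : Fin d → ℝ}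
    (hp : ∀ i, HasSum (p i) 1) (hl : ∀ i, HasSum (fun n => p i n * l i n) (a i)) :
    HasSum (fun x : Fin d → ℕ => (∏ i, p i (x i)) * ∑ i, l i (x i)) (∑ i, a i) := by
  simp_rw [Finset.mul_sum]
  refine hasSum_sum fun i _ => ?_
  have h := hasSum_pi_prod (f := Function.update p i fun n => p i n * l i n)
    (a := Function.update (fun _ => 1) i (a i)) fun j => by
      rcases eq_or_ne j i with rfl | hj
      · simpa using hl j
      · simpa [hj] using hp j
  have ha : ∏ j, Function.update (fun _ => (1 : ℝ)) i (a i) j = a i := by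
    rw [Finset.prod_update_of_mem (Finset.mem_univ i)]; simp
  rw [ha] at h
  refine h.congr_fun fun x => ?_
  rw [← Finset.mul_prod_erase _ _ (Finset.mem_univ i),
    ← Finset.mul_prod_erase _ (fun j => Function.update p i (fun n => p i n * l i n) j (x j))
      (Finset.mem_univ i)]
  have : ∏ j ∈ Finset.univ.erase i, Function.update p i (fun n => p i n * l i n) j (x j)
      = ∏ j ∈ Finset.univ.erase i, p j (x j) :=
    Finset.prod_congr rfl fun j hj => by rw [Function.update_of_ne (Finset.ne_of_mem_erase hj)]
  rw [this, Function.update_self]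
  ring

/-! ### Gamma integrals and the closed form of the predictive distribution. -/

theorem integrableOn_gamma {a c : ℝ} (ha : 0 < a) (hc : 0 < c) :
    IntegrableOn (fun t : ℝ => t ^ (a - 1) * Real.exp (-(c * t))) (Set.Ioi 0) := by
  have hG := Real.Gamma_pos_of_pos ha
  -- A non-integrable function has integral 0 by convention, so a nonzero value forces
  -- integrability.
  exact .of_integral_ne_zero (by rw [Real.integral_rpow_mul_exp_neg_mul_Ioi ha hc]; positivity)

theorem restrict_orthant (d : ℕ) :
    (volume : Measure (Fin d → ℝ)).restrict (orthant d)
      = Measure.pi fun _ => (volume : Measure ℝ).restrict (Set.Ioi 0) := by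
  rw [orthant, volume_pi, Measure.restrict_pi_pi]

section Orthant

variable {d : ℕ} {g : Fin d → ℝ → ℝ} {K a : Fin d → ℝ} {c : ℝ}

theorem integrableOn_orthant_prod (ha : ∀ i, 0 < a i) (hc : 0 < c)
    (hg : ∀ i, ∀ t > 0, g i t = K i * (t ^ (a i - 1) * Real.exp (-(c * t)))) :
    IntegrableOn (fun t => ∏ i, g i (t i)) (orthant d) := by
  rw [IntegrableOn, restrict_orthant]
  refine Integrable.fintype_prod fun i => ?_
  refine IntegrableOn.congr_fun ((integrableOn_gamma (ha i) hc).const_mul (K i))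
    (fun t ht => (hg i t ht).symm) measurableSet_Ioi

theorem integral_orthant_prod (ha : ∀ i, 0 < a i) (hc : 0 < c)
    (hg : ∀ i, ∀ t > 0, g i t = K i * (t ^ (a i - 1) * Real.exp (-(c * t)))) :
    ∫ t in orthant d, ∏ i, g i (t i)
      = ∏ i, K i * ((1 / c) ^ a i * Real.Gamma (a i)) := by
  rw [restrict_orthant, integral_fintype_prod_eq_prod]
  refine Finset.prod_congr rfl fun i _ => ?_
  rw [setIntegral_congr_fun measurableSet_Ioi (fun t ht => hg i t ht), integral_const_mul,
    Real.integral_rpow_mul_exp_neg_mul_Ioi (ha i) hc]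

end Orthant

theorem poissonPMF_eq_prod {d : ℕ} (c : ℝ) (lam : Fin d → ℝ) (x : Fin d → ℕ) :
    poissonPMF c lam x = ∏ i, poissonWeight (c * lam i) (x i) := rfl

theorem poissonWeight_mul_rpow {r t : ℝ} (ht : 0 < t) (n : ℕ) :
    poissonWeight (r * t) n * t ^ (-(1 / 2) : ℝ)
      = r ^ n / n.factorial * (t ^ ((n : ℝ) + 1 / 2 - 1) * Real.exp (-(r * t))) := by
  have : t ^ ((n : ℝ) + 1 / 2 - 1) = t ^ n * t ^ (-(1 / 2) : ℝ) := by
    rw [← Real.rpow_natCast, ← Real.rpow_add ht]; congr 1; ring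
  rw [this, poissonWeight, mul_pow]
  ring

theorem poissonWeight_mul_mul_rpow {r s t : ℝ} (ht : 0 < t) (n k : ℕ) :
    poissonWeight (r * t) n * poissonWeight (s * t) k * t ^ (-(1 / 2) : ℝ)
      = r ^ n / n.factorial * (s ^ k / k.factorial) *
        (t ^ (((n + k : ℕ) : ℝ) + 1 / 2 - 1) * Real.exp (-((r + s) * t))) := by
  have : t ^ (((n + k : ℕ) : ℝ) + 1 / 2 - 1) = t ^ n * t ^ k * t ^ (-(1 / 2) : ℝ) := by
    rw [← pow_add, ← Real.rpow_natCast, ← Real.rpow_add ht]; congr 1; ring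
  rw [this, poissonWeight, poissonWeight, mul_pow, mul_pow, add_mul, neg_add, Real.exp_add]
  ring

/-- The Jeffreys predictive probability for a single Poisson variable. -/
noncomputable def predictiveCoord (r s : ℝ) (x y : ℕ) : ℝ :=
  s ^ y / y.factorial * ((1 / (r + s)) ^ (((x + y : ℕ) : ℝ) + 1 / 2)
    * Real.Gamma (((x + y : ℕ) : ℝ) + 1 / 2))
    / ((1 / r) ^ ((x : ℝ) + 1 / 2) * Real.Gamma ((x : ℝ) + 1 / 2))

section Predictive

variable {d : ℕ} {r s : ℝ}

theorem prior_integrand_eq (x : Fin d → ℕ) (t : Fin d → ℝ) :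
    poissonPMF r t x * jeffreysPrior t
      = ∏ i, poissonWeight (r * t i) (x i) * t i ^ (-(1 / 2) : ℝ) := by
  rw [Finset.prod_mul_distrib]; rfl

theorem joint_integrand_eq (x y : Fin d → ℕ) (t : Fin d → ℝ) :
    poissonPMF r t x * poissonPMF s t y * jeffreysPrior t
      = ∏ i, poissonWeight (r * t i) (x i) * poissonWeight (s * t i) (y i)
        * t i ^ (-(1 / 2) : ℝ) := by
  rw [Finset.prod_mul_distrib, Finset.prod_mul_distrib]; rfl

theorem integrableOn_prior_integrand (hr : 0 < r) (x : Fin d → ℕ) :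
    IntegrableOn (fun t => poissonPMF r t x * jeffreysPrior t) (orthant d) := by
  simp_rw [prior_integrand_eq]
  exact integrableOn_orthant_prod
    (g := fun i t => poissonWeight (r * t) (x i) * t ^ (-(1 / 2) : ℝ))
    (fun i => by positivity) hr fun i t ht => poissonWeight_mul_rpow ht (x i)

theorem integrableOn_joint_integrand (hr : 0 < r) (hs : 0 < s) (x y : Fin d → ℕ) :
    IntegrableOn (fun t => poissonPMF r t x * poissonPMF s t y * jeffreysPrior t)
      (orthant d) := by
  simp_rw [joint_integrand_eq]
  exact integrableOn_orthant_prod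
    (g := fun i t => poissonWeight (r * t) (x i) * poissonWeight (s * t) (y i)
      * t ^ (-(1 / 2) : ℝ))
    (fun i => by positivity) (add_pos hr hs)
    fun i t ht => poissonWeight_mul_mul_rpow ht (x i) (y i)

theorem jeffreysPredictive_eq_prod (hr : 0 < r) (hs : 0 < s) (x y : Fin d → ℕ) :
    jeffreysPredictive r s x y = ∏ i, predictiveCoord r s (x i) (y i) := by
  unfold jeffreysPredictive
  simp_rw [prior_integrand_eq, joint_integrand_eq]
  rw [integral_orthant_prod
      (g := fun i t => poissonWeight (r * t) (x i) * t ^ (-(1 / 2) : ℝ))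
      (fun i => by positivity) hr fun i t ht => poissonWeight_mul_rpow ht (x i),
    integral_orthant_prod
      (g := fun i t => poissonWeight (r * t) (x i) * poissonWeight (s * t) (y i)
        * t ^ (-(1 / 2) : ℝ))
      (fun i => by positivity) (add_pos hr hs)
      fun i t ht => poissonWeight_mul_mul_rpow ht (x i) (y i),
    ← Finset.prod_div_distrib]
  refine Finset.prod_congr rfl fun i _ => ?_
  -- The common factor `r ^ x / x!` of numerator and denominator cancels.
  rw [mul_assoc, mul_div_mul_left _ _ (by positivity), predictiveCoord]

theorem predictiveCoord_pos (hr : 0 < r) (hs : 0 < s) (x y : ℕ) :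
    0 < predictiveCoord r s x y := by
  have h1 : 0 < Real.Gamma (((x + y : ℕ) : ℝ) + 1 / 2) := Real.Gamma_pos_of_pos (by positivity)
  have h2 : 0 < Real.Gamma ((x : ℝ) + 1 / 2) := Real.Gamma_pos_of_pos (by positivity)
  unfold predictiveCoord
  positivity

theorem log_predictiveCoord (hr : 0 < r) (hs : 0 < s) (x y : ℕ) :
    Real.log (predictiveCoord r s x y) = y * Real.log s - Real.log y.factorial
      - (x + y + 1 / 2) * Real.log (r + s) + Real.log (Real.Gamma (((x + y : ℕ) : ℝ) + 1 / 2))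
      + (x + 1 / 2) * Real.log r - Real.log (Real.Gamma (x + 1 / 2)) := by
  have h1 : 0 < Real.Gamma (((x + y : ℕ) : ℝ) + 1 / 2) := Real.Gamma_pos_of_pos (by positivity)
  have h2 : 0 < Real.Gamma ((x : ℝ) + 1 / 2) := Real.Gamma_pos_of_pos (by positivity)
  have h3 : 0 < r + s := add_pos hr hs
  have h4 : (0 : ℝ) < (1 / (r + s)) ^ (((x + y : ℕ) : ℝ) + 1 / 2) := by positivity
  have h5 : (0 : ℝ) < (1 / r) ^ ((x : ℝ) + 1 / 2) := by positivity
  have h6 : (y.factorial : ℝ) ≠ 0 := by positivity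
  unfold predictiveCoord
  rw [Real.log_div (by positivity) (by positivity), Real.log_mul (by positivity) (by positivity),
    Real.log_div (by positivity) h6, Real.log_mul h4.ne' h1.ne', Real.log_mul h5.ne' h2.ne',
    Real.log_rpow (by positivity), Real.log_rpow (by positivity), Real.log_pow, one_div (r + s),
    one_div r, Real.log_inv, Real.log_inv]
  push_cast
  ring

end Predictive

/-! ### Loss and risk in one coordinate. -/

section Risk

variable {r s l : ℝ}

/-- The logarithmic loss of the predictive probability in one coordinate, where the true mean
parameter is `l`. -/
noncomputable def lossCoord (r s l : ℝ) (x y : ℕ) : ℝ :=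
  (-(s * l) + (x + 1 / 2) * (Real.log (r + s) - Real.log r)
      + Real.log (Real.Gamma (x + 1 / 2)))
    + (Real.log l + Real.log (r + s)) * y - Real.log (Real.Gamma (((x + y : ℕ) : ℝ) + 1 / 2))

theorem log_div_predictiveCoord (hr : 0 < r) (hs : 0 < s) (hl : 0 ≤ l) (x y : ℕ)
    (hw : poissonWeight (s * l) y ≠ 0) :
    Real.log (poissonWeight (s * l) y / predictiveCoord r s x y) = lossCoord r s l x y := by
  have h6 : (y.factorial : ℝ) ≠ 0 := by positivity
  rw [Real.log_div hw (predictiveCoord_pos hr hs x y).ne', log_predictiveCoord hr hs, lossCoord]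
  have hpow : (s * l) ^ y ≠ 0 := fun h => hw (by simp [poissonWeight, h])
  have hlog : (y : ℝ) * Real.log (s * l) = y * Real.log s + y * Real.log l := by
    -- At `l = 0` a nonzero weight forces `y = 0`, so the value of `Real.log 0` is irrelevant.
    rcases hl.eq_or_lt with rfl | hl
    · have : y = 0 := by
        by_contra hy
        simp [hy] at hpow
      simp [this]
    · rw [Real.log_mul hs.ne' hl.ne']; ring
  rw [poissonWeight, Real.log_div (mul_ne_zero (Real.exp_ne_zero _) hpow) h6,
    Real.log_mul (Real.exp_ne_zero _) hpow, Real.log_exp, Real.log_pow, hlog]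
  ring

theorem klTerm_eq {d : ℕ} {lam : Fin d → ℝ} (hr : 0 < r) (hs : 0 < s) (hlam : ∀ i, 0 ≤ lam i)
    (x y : Fin d → ℕ) :
    klTerm (poissonPMF s lam) (jeffreysPredictive r s x) y
      = (∏ i, poissonWeight (s * lam i) (y i)) * ∑ i, lossCoord r s (lam i) (x i) (y i) := by
  rw [klTerm, jeffreysPredictive_eq_prod hr hs, poissonPMF_eq_prod]
  -- Where the true probability vanishes, both sides are 0 whatever the logarithm; elsewhere every
  -- factor is nonzero and the logarithm splits.
  by_cases h : ∏ i, poissonWeight (s * lam i) (y i) = 0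
  · rw [h, zero_mul, zero_mul]
  · have hw := Finset.prod_ne_zero_iff.mp h
    rw [← Finset.prod_div_distrib, Real.log_prod fun i hi =>
      div_ne_zero (hw i hi) (predictiveCoord_pos hr hs _ _).ne']
    congr 1
    exact Finset.sum_congr rfl fun i hi =>
      log_div_predictiveCoord hr hs (hlam i) _ _ (hw i hi)

theorem expBounded_lossCoord (r s l : ℝ) (x : ℕ) : ExpBounded (lossCoord r s l x) :=
  ((expBounded_const _).add (expBounded_natCast.const_mul _)).sub (expBounded_log_Gamma.shift x)

theorem poissonExp_lossCoord (r s l : ℝ) (x : ℕ) :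
    poissonExp (s * l) (lossCoord r s l x)
      = (-(s * l) + 1 / 2 * (Real.log (r + s) - Real.log r)
          + (Real.log l + Real.log (r + s)) * (s * l))
        + (Real.log (r + s) - Real.log r) * x + Real.log (Real.Gamma (x + 1 / 2))
        - poissonExp (s * l) (fun y => Real.log (Real.Gamma (((x + y : ℕ) : ℝ) + 1 / 2))) := by
  unfold lossCoord
  rw [poissonExp_sub ((expBounded_const _).add (expBounded_natCast.const_mul _))
      (expBounded_log_Gamma.shift x),
    poissonExp_add (expBounded_const _) (expBounded_natCast.const_mul _), poissonExp_const,
    poissonExp_const_mul, poissonExp_natCast]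
  ring

/-- The Kullback-Leibler risk of the Jeffreys predictive distribution in one dimension. -/
theorem hasSum_riskCoord (hr : 0 < r) (hs : 0 < s) (hl : 0 ≤ l) :
    HasSum (fun x => poissonWeight (r * l) x * poissonExp (s * l) (lossCoord r s l x))
      (logGammaGap (r * l) - logGammaGap ((r + s) * l)
        + 1 / 2 * (Real.log (r + s) - Real.log r)) := by
  have hB := (expBounded_const (-(s * l) + 1 / 2 * (Real.log (r + s) - Real.log r)
          + (Real.log l + Real.log (r + s)) * (s * l))).add
        (expBounded_natCast.const_mul (Real.log (r + s) - Real.log r))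
  have h1 := (hB.add expBounded_log_Gamma).hasSum (r * l)
  rw [poissonExp_add hB expBounded_log_Gamma, poissonExp_add (expBounded_const _)
      (expBounded_natCast.const_mul _), poissonExp_const, poissonExp_const_mul,
    poissonExp_natCast] at h1
  -- The double expectation of `log Γ(x + y + 1/2)` collapses to one expectation with mean `r l + s
  -- l`.
  have h2 := h1.sub (expBounded_log_Gamma.hasSum_conv (mul_nonneg hr.le hl) (mul_nonneg hs.le hl))
  rw [← add_mul] at h2
  have e : logGammaGap (r * l) - logGammaGap ((r + s) * l)
        + 1 / 2 * (Real.log (r + s) - Real.log r)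
      = -(s * l) + 1 / 2 * (Real.log (r + s) - Real.log r)
          + (Real.log l + Real.log (r + s)) * (s * l)
        + (Real.log (r + s) - Real.log r) * (r * l)
        + poissonExp (r * l) (fun n => Real.log (Real.Gamma (n + 1 / 2)))
        - poissonExp ((r + s) * l) (fun n => Real.log (Real.Gamma (n + 1 / 2))) := by
    unfold logGammaGap
    rcases hl.eq_or_lt with rfl | hl
    · simp
    · rw [Real.log_mul hr.ne' hl.ne', Real.log_mul (add_pos hr hs).ne' hl.ne']
      ring
  rw [e]
  refine HasSum.congr_fun h2 fun x => ?_
  rw [poissonExp_lossCoord, mul_sub]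

theorem riskCoord_lt (hr : 0 < r) (hs : 0 < s) (hl : 0 ≤ l) :
    logGammaGap (r * l) - logGammaGap ((r + s) * l) + 1 / 2 * (Real.log (r + s) - Real.log r)
      < 0.52 * Real.log ((r + s) / r) := by
  have hrs : 0 < r + s := add_pos hr hs
  rw [Real.log_div hrs.ne' hr.ne']
  rcases hl.eq_or_lt with rfl | hl
  -- At `l = 0` the two gaps cancel and only the constant `1/2 < 0.52` remains.
  · have : Real.log r < Real.log (r + s) := Real.log_lt_log hr (by linarith)
    norm_num
    linarith
  -- Monotonicity between `r l` and `(r + s) l` costs `1/50` of the difference of their logarithms,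
  -- from which `l` drops out.
  · have h := logGammaGap_add_log_strictMonoOn (Set.mem_Ioi.mpr (mul_pos hr hl))
      (Set.mem_Ioi.mpr (mul_pos hrs hl)) (by nlinarith)
    simp only at h
    rw [Real.log_mul hr.ne' hl.ne', Real.log_mul hrs.ne' hl.ne'] at h
    norm_num
    linarith

end Risk

end PoissonPrediction

/-! ### Assembly over the coordinates. -/

open PoissonPrediction in
/-- The predictive distribution is well defined and everywhere positive (the three integrability
and positivity clauses), the series defining the loss and the risk converge absolutely, and the
risk is less than `0.52 d log((r+s)/r)`. -/
theorem theorem1 (d : ℕ) (hd : 1 ≤ d) (r s : ℝ) (hr : 0 < r) (hs : 0 < s)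
    (lam : Fin d → ℝ) (hlam : ∀ i, 0 ≤ lam i) :
    (∀ x : Fin d → ℕ,
      IntegrableOn (fun t => poissonPMF r t x * jeffreysPrior t) (orthant d)) ∧
    (∀ x y : Fin d → ℕ,
      IntegrableOn (fun t => poissonPMF r t x * poissonPMF s t y * jeffreysPrior t)
        (orthant d)) ∧
    (∀ x y : Fin d → ℕ, 0 < jeffreysPredictive r s x y) ∧
    (∀ x : Fin d → ℕ, Summable (klTerm (poissonPMF s lam) (jeffreysPredictive r s x))) ∧
    Summable (klRiskTerm r s lam (jeffreysPredictive r s)) ∧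
    klRisk r s lam (jeffreysPredictive r s) < 0.52 * d * Real.log ((r + s) / r) := by
  have hloss : ∀ x : Fin d → ℕ, HasSum (klTerm (poissonPMF s lam) (jeffreysPredictive r s x))
      (∑ i, poissonExp (s * lam i) (lossCoord r s (lam i) (x i))) := fun x => by
    simp_rw [funext (klTerm_eq hr hs hlam x)]
    exact hasSum_pi_prod_mul_sum (fun i => hasSum_poissonWeight _)
      fun i => (expBounded_lossCoord r s (lam i) (x i)).hasSum _
  have hrisk : HasSum (klRiskTerm r s lam (jeffreysPredictive r s))
      (∑ i, (logGammaGap (r * lam i) - logGammaGap ((r + s) * lam i)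
        + 1 / 2 * (Real.log (r + s) - Real.log r))) := by
    have h : klRiskTerm r s lam (jeffreysPredictive r s) = fun x =>
        (∏ i, poissonWeight (r * lam i) (x i)) *
          ∑ i, poissonExp (s * lam i) (lossCoord r s (lam i) (x i)) := by
      funext x
      rw [klRiskTerm, klLoss, (hloss x).tsum_eq, poissonPMF_eq_prod]
    rw [h]
    exact hasSum_pi_prod_mul_sum (l := fun i n => poissonExp (s * lam i) (lossCoord r s (lam i) n))
      (fun i => hasSum_poissonWeight _) fun i => hasSum_riskCoord hr hs (hlam i)
  refine ⟨integrableOn_prior_integrand hr, integrableOn_joint_integrand hr hs, fun x y => ?_,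
    fun x => (hloss x).summable, hrisk.summable, ?_⟩
  · rw [jeffreysPredictive_eq_prod hr hs]
    exact Finset.prod_pos fun i _ => predictiveCoord_pos hr hs _ _
  · rw [klRisk, hrisk.tsum_eq]
    -- At least one coordinate is needed for the summed inequality to be strict.
    have hne : (Finset.univ : Finset (Fin d)).Nonempty := ⟨⟨0, hd⟩, Finset.mem_univ _⟩
    refine (Finset.sum_lt_sum_of_nonempty hne fun i _ => riskCoord_lt hr hs (hlam i)).trans_eq ?_
    simp
    ring
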